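/- Let $n\ge 1$ and let $\mathfrak S_n$ be the set of permutations of $\{1,\dots,n\}$. For $\sigma\in\mathfrak S_n$ let $wex(\sigma)$ be the number of weak exceedances of $\sigma$, i.e. of $i$ with $\sigma(i)\ge i$, and let $cr(\sigma)$ be the number of crossings of $\sigma$, i.e. of pairs $(i,j)$ such that either $i<j\le\sigma(i)<\sigma(j)$ or $\sigma(i)<\sigma(j)<i<j$. Let $q$ be an indeterminate, $[k]_q=\frac{1-q^k}{1-q}=1+q+\dots+q^{k-1}$, and let the $q$-tangent numbers $E_{2m+1}(q)\in\mathbb Z[q]$, $m\ge 0$, be defined by the continued fraction expansion (in formal power series in $x$) $$\sum_{m\ge 0}E_{2m+1}(q)\,x^m=\cfrac{1}{1-\cfrac{[1]_q[2]_q\,x}{1-\cfrac{[2]_q[3]_q\,x}{1-\cfrac{[3]_q[4]_q\,x}{\ddots}}}}.$$ Then $$\sum_{\sigma\in\mathfrak S_n}(-1)^{wex(\sigma)}q^{cr(\sigma)}=\begin{cases}0&\text{if } n \text{ is even},\\ (-1)^{\frac{n+1}{2}}E_n(q)&\text{if } n \text{ is odd}.\end{cases}$$ -/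

import Mathlib

open scoped Polynomial PowerSeries

/-- The number of weak exceedances of `σ`: the positions `i` with `σ i ≥ i`. -/
def wex {n : ℕ} (σ : Equiv.Perm (Fin n)) : ℕ :=
  (Finset.univ.filter fun i : Fin n => i ≤ σ i).card

/-- The number of crossings of `σ`: the pairs `(i, j)` such that either
`i < j ≤ σ i < σ j` or `σ i < σ j < i < j`. -/
def crossings {n : ℕ} (σ : Equiv.Perm (Fin n)) : ℕ :=
  (Finset.univ.filter fun p : Fin n × Fin n =>
    (p.1 < p.2 ∧ p.2 ≤ σ p.1 ∧ σ p.1 < σ p.2) ∨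
      (σ p.1 < σ p.2 ∧ σ p.2 < p.1 ∧ p.1 < p.2)).card

/-- The `q`-integer `[n]_q = 1 + q + ⋯ + q^(n-1)`, as a polynomial in the indeterminate `q`. -/
noncomputable def qInt (n : ℕ) : ℤ[X] := ∑ i ∈ Finset.range n, Polynomial.X ^ i

/-- The usual form of the `q`-integer: `[n]_q (1 - q) = 1 - q^n`. -/
theorem qInt_mul_one_sub (n : ℕ) :
    qInt n * (1 - Polynomial.X) = 1 - Polynomial.X ^ n := by
  unfold qInt
  exact geom_sum_mul_neg _ n

/-- The finite continued fraction of depth `N`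
`1 / (1 - c 0 x / (1 - c 1 x / (⋯ / (1 - c (N-1) x))))`
as a formal power series in `x`. Each division is by a series of constant term `1`. -/
noncomputable def cfConvergent {R : Type*} [CommRing R] : ℕ → (ℕ → R) → R⟦X⟧
  | 0, _ => 1
  | N + 1, c =>
      PowerSeries.invOfUnit
        (1 - PowerSeries.C (c 0) * PowerSeries.X * cfConvergent N fun k => c (k + 1)) 1

/-- The infinite continued fraction `1 / (1 - c 0 x / (1 - c 1 x / (1 - c 2 x / ⋯)))`, the
limit of its convergents in the ring of formal power series: the coefficient of `x ^ n` is the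
one of the convergent of depth `n`, and of all deeper ones (`coeff_cfConvergent`). -/
noncomputable def contFrac {R : Type*} [CommRing R] (c : ℕ → R) : R⟦X⟧ :=
  PowerSeries.mk fun n => PowerSeries.coeff n (cfConvergent n c)

theorem cfConvergent_mul {R : Type*} [CommRing R] (N : ℕ) (c : ℕ → R) :
    (1 - PowerSeries.C (c 0) * PowerSeries.X * cfConvergent N fun k => c (k + 1)) *
      cfConvergent (N + 1) c = 1 := by
  rw [cfConvergent]
  exact PowerSeries.mul_invOfUnit _ 1 (by simp)

theorem X_pow_dvd_cfConvergent_sub {R : Type*} [CommRing R] (n : ℕ) :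
    ∀ (N M : ℕ) (c : ℕ → R), n ≤ N → n ≤ M →
      (PowerSeries.X : R⟦X⟧) ^ (n + 1) ∣ cfConvergent N c - cfConvergent M c := by
  have key : ∀ (n N M : ℕ) (c : ℕ → R),
      (PowerSeries.X : R⟦X⟧) ^ n ∣
        cfConvergent N (fun k => c (k + 1)) - cfConvergent M (fun k => c (k + 1)) →
      (PowerSeries.X : R⟦X⟧) ^ (n + 1) ∣ cfConvergent (N + 1) c - cfConvergent (M + 1) c := by
    rintro n N M c ⟨d, hd⟩
    refine ⟨PowerSeries.C (c 0) * d * cfConvergent (N + 1) c * cfConvergent (M + 1) c, ?_⟩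
    have h1 := cfConvergent_mul N c
    have h2 := cfConvergent_mul M c
    linear_combination cfConvergent (M + 1) c * h1 - cfConvergent (N + 1) c * h2 +
      PowerSeries.C (c 0) * PowerSeries.X * cfConvergent (N + 1) c * cfConvergent (M + 1) c * hd
  have one : ∀ (N : ℕ) (c : ℕ → R),
      (PowerSeries.X : R⟦X⟧) ∣ cfConvergent N c - 1 := by
    intro N c
    cases N with
    | zero => simp [cfConvergent]
    | succ N =>
      have h := cfConvergent_mul N c
      refine ⟨PowerSeries.C (c 0) * (cfConvergent N fun k => c (k + 1)) *
        cfConvergent (N + 1) c, ?_⟩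
      linear_combination h
  induction n with
  | zero =>
    intro N M c _ _
    have h := dvd_sub (one N c) (one M c)
    simpa using h
  | succ n ih =>
    intro N M c hN hM
    obtain ⟨N, rfl⟩ : ∃ k, N = k + 1 := ⟨N - 1, by omega⟩
    obtain ⟨M, rfl⟩ : ∃ k, M = k + 1 := ⟨M - 1, by omega⟩
    exact key (n + 1) N M c (ih N M _ (by omega) (by omega))

/-- The convergents do converge, coefficient by coefficient, to the continued fraction. -/
theorem coeff_cfConvergent {R : Type*} [CommRing R] (c : ℕ → R) {n N : ℕ} (h : n ≤ N) :
    PowerSeries.coeff n (cfConvergent N c) = PowerSeries.coeff n (contFrac c) := by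
  have hd := PowerSeries.X_pow_dvd_iff.mp
    (X_pow_dvd_cfConvergent_sub n N n c h le_rfl) n (Nat.lt_succ_self n)
  rw [map_sub, sub_eq_zero] at hd
  rw [hd, contFrac, PowerSeries.coeff_mk]

/-- `qTangent m` is the `q`-tangent number `E_{2m+1}(q)`, defined by
`∑ E_{2m+1}(q) x^m = 1 / (1 - [1][2] x / (1 - [2][3] x / (1 - [3][4] x / ⋯)))`. -/
noncomputable def qTangent (m : ℕ) : ℤ[X] :=
  PowerSeries.coeff m (contFrac fun k => qInt (k + 1) * qInt (k + 2))

/-! Let `S(n, h)` be the signed sum over permutations sending no point of `{0, …, h-1}` into that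
set. Enlarging this empty corner by one row (`signedSum_row`) and then one column
(`signedSum_column`) removes an arc each time. The arc's crossings are determined by its free
endpoint, so summing over that endpoint gives a `q`-integer. The result is a three-term recurrence
in `h` whose middle coefficient is `[h+1] - [h+2] = -q^(h+1)`.

With `n = h + m`, the recurrence expresses level `m + 1` through lower levels, so any family of
series obeying it with the same initial values is the generating function. `signedSeries` is such a
family, built from the tails `T_k` of the tangent fraction at `-x²`. At `h = 0` no permutation is
excluded and the series is `1 - x T_0`. As `T_0` is even, only odd powers survive beyond the
constant term. -/

/-! ### Inserting a point into a permutation -/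

/-- The permutation of `Fin (n + 1)` that maps `i` to `v` and acts as `τ` on the other points,
after the order-preserving relabelling of domain and codomain. -/
def insertPoint {n : ℕ} (i v : Fin (n + 1)) (τ : Equiv.Perm (Fin n)) :
    Equiv.Perm (Fin (n + 1)) :=
  (finSuccEquiv' i).trans (τ.optionCongr.trans (finSuccEquiv' v).symm)

@[simp]
theorem insertPoint_self {n : ℕ} (i v : Fin (n + 1)) (τ : Equiv.Perm (Fin n)) :
    insertPoint i v τ i = v := by
  simp [insertPoint]

@[simp]
theorem insertPoint_succAbove {n : ℕ} (i v : Fin (n + 1)) (τ : Equiv.Perm (Fin n)) (j : Fin n) :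
    insertPoint i v τ (i.succAbove j) = v.succAbove (τ j) := by
  simp [insertPoint]

theorem insertPoint_injective {n : ℕ} (i v : Fin (n + 1)) :
    Function.Injective (insertPoint i v) := by
  intro τ τ' h
  ext1 j
  have := congrArg (fun σ => σ (i.succAbove j)) h
  simpa using this

theorem sum_perm_insert_value {n : ℕ} {M : Type*} [AddCommMonoid M]
    (i : Fin (n + 1)) (f : Equiv.Perm (Fin (n + 1)) → M) :
    ∑ σ, f σ = ∑ v, ∑ τ, f (insertPoint i v τ) := by
  rw [← Fintype.sum_prod_type']
  refine (Fintype.sum_bijective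
    (fun p : Fin (n + 1) × Equiv.Perm (Fin n) => insertPoint i p.1 p.2) ?_ _ _
      fun _ => rfl).symm
  rw [Fintype.bijective_iff_injective_and_card]
  refine ⟨?_, by simp [Fintype.card_perm, Nat.factorial_succ]⟩
  rintro ⟨v, τ⟩ ⟨v', τ'⟩ h
  obtain rfl : v = v' := by simpa using congrArg (fun σ => σ i) h
  exact congrArg _ (insertPoint_injective i v h)

theorem sum_perm_insert_position {n : ℕ} {M : Type*} [AddCommMonoid M]
    (v : Fin (n + 1)) (f : Equiv.Perm (Fin (n + 1)) → M) :
    ∑ σ, f σ = ∑ i, ∑ τ, f (insertPoint i v τ) := by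
  rw [← Fintype.sum_prod_type']
  refine (Fintype.sum_bijective
    (fun p : Fin (n + 1) × Equiv.Perm (Fin n) => insertPoint p.1 v p.2) ?_ _ _
      fun _ => rfl).symm
  rw [Fintype.bijective_iff_injective_and_card]
  refine ⟨?_, by simp [Fintype.card_perm, Nat.factorial_succ]⟩
  rintro ⟨i, τ⟩ ⟨i', τ'⟩ h
  obtain rfl : i = i' := by
    apply (insertPoint i v τ).injective
    simpa using (congrArg (fun σ => σ i') h).symm
  exact congrArg _ (insertPoint_injective i v h)

theorem val_succAbove {n : ℕ} (i : Fin (n + 1)) (j : Fin n) :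
    (i.succAbove j : ℕ) = if (j : ℕ) < i then (j : ℕ) else j + 1 := by
  simp only [Fin.succAbove, Fin.lt_def, Fin.val_castSucc]
  split_ifs <;> simp

/-! ### Crossings and weak exceedances of an insertion -/

/-- The arcs `i ↦ a` and `j ↦ b` cross, in this order. -/
def ArcCross (i a j b : ℕ) : Prop :=
  (i < j ∧ j ≤ a ∧ a < b) ∨ (a < b ∧ b < i ∧ i < j)

instance (i a j b : ℕ) : Decidable (ArcCross i a j b) := by
  unfold ArcCross; infer_instance

theorem crossings_eq_sum {n : ℕ} (σ : Equiv.Perm (Fin n)) :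
    crossings σ = ∑ i : Fin n, ∑ j : Fin n, if ArcCross i (σ i) j (σ j) then 1 else 0 := by
  rw [crossings, Finset.card_filter, Fintype.sum_prod_type]
  rfl

theorem wex_eq_sum {n : ℕ} (σ : Equiv.Perm (Fin n)) :
    wex σ = ∑ i : Fin n, if (i : ℕ) ≤ σ i then 1 else 0 := by
  rw [wex, Finset.card_filter]
  rfl

/-- The hypothesis is needed because positions and values are relabelled separately, which may alter
comparisons between a position and a value. -/
theorem crossings_insertPoint {n : ℕ} (i v : Fin (n + 1)) (τ : Equiv.Perm (Fin n))
    (h : ∀ j k : Fin n, ArcCross (i.succAbove j) (v.succAbove (τ j)) (i.succAbove k)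
      (v.succAbove (τ k)) ↔ ArcCross j (τ j) k (τ k)) :
    crossings (insertPoint i v τ) = crossings τ +
      ((∑ j : Fin (n + 1), if ArcCross i v j (insertPoint i v τ j) then 1 else 0) +
        ∑ j : Fin (n + 1), if ArcCross j (insertPoint i v τ j) i v then 1 else 0) := by
  have h0 : ¬ ArcCross i v i v := by simp [ArcCross]
  simp only [crossings_eq_sum, Fin.sum_univ_succAbove _ i, insertPoint_self,
    insertPoint_succAbove, h, Finset.sum_add_distrib, if_neg h0]
  ring

theorem wex_insertPoint {n : ℕ} (i v : Fin (n + 1)) (τ : Equiv.Perm (Fin n))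
    (h : ∀ j : Fin n, (i.succAbove j : ℕ) ≤ v.succAbove (τ j) ↔ (j : ℕ) ≤ τ j) :
    wex (insertPoint i v τ) = (if (i : ℕ) ≤ v then 1 else 0) + wex τ := by
  simp only [wex_eq_sum, Fin.sum_univ_succAbove _ i, insertPoint_self, insertPoint_succAbove, h]

theorem sum_indicator_Ioc {n a b : ℕ} (hb : b < n) :
    (∑ j : Fin n, if a < (j : ℕ) ∧ (j : ℕ) ≤ b then 1 else 0) = b - a := by
  rw [Fin.sum_univ_eq_sum_range (fun j => if a < j ∧ j ≤ b then 1 else 0) n,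
    ← Finset.card_filter, ← Nat.card_Ioc]
  congr 1
  ext j
  simp only [Finset.mem_filter, Finset.mem_range, Finset.mem_Ioc]
  omega

theorem sum_perm_indicator {n : ℕ} (σ : Equiv.Perm (Fin n)) (p : ℕ → Prop) [DecidablePred p] :
    (∑ j, if p (σ j) then 1 else 0) = ∑ j : Fin n, if p j then 1 else 0 :=
  Equiv.sum_comp σ fun j : Fin n => if p j then 1 else 0

/-- The arcs starting below `u` do not end below `l`. -/
def Avoids {n : ℕ} (u l : ℕ) (σ : Equiv.Perm (Fin n)) : Prop :=
  ∀ i : Fin n, (i : ℕ) < u → l ≤ (σ i : ℕ)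

instance {n : ℕ} (u l : ℕ) (σ : Equiv.Perm (Fin n)) : Decidable (Avoids u l σ) := by
  unfold Avoids; infer_instance

theorem avoids_insertPoint_iff {n : ℕ} (u l : ℕ) (i v : Fin (n + 1)) (τ : Equiv.Perm (Fin n)) :
    Avoids u l (insertPoint i v τ) ↔ ((i : ℕ) < u → l ≤ (v : ℕ)) ∧
      ∀ j : Fin n, (i.succAbove j : ℕ) < u → l ≤ (v.succAbove (τ j) : ℕ) := by
  rw [Avoids, Fin.forall_iff_succAbove i]
  simp

/-- Closing an arc that starts at `i ≤ h` and ends at the first unprocessed value `h`. -/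
theorem avoids_insertPoint_upper {n h : ℕ} {i v : Fin (n + 1)} (hv : (v : ℕ) = h)
    (hi : (i : ℕ) ≤ h) (τ : Equiv.Perm (Fin n)) :
    Avoids (h + 1) h (insertPoint i v τ) ↔ Avoids h h τ := by
  rw [avoids_insertPoint_iff, Avoids]
  simp only [val_succAbove]
  constructor
  · rintro ⟨-, H⟩ j hj
    have := H j
    split_ifs at this <;> omega
  · refine fun H => ⟨by omega, fun j hj => ?_⟩
    have := H j
    split_ifs at hj ⊢ <;> omega

/-- The empty corner forces every other arc starting at or before `h` to end above `h`. Hence the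
new arc crosses exactly those starting in `(i, h]`. -/
theorem weight_insertPoint_upper {n h : ℕ} {i v : Fin (n + 1)} (hv : (v : ℕ) = h)
    (hi : (i : ℕ) ≤ h) {τ : Equiv.Perm (Fin n)} (hτ : Avoids h h τ) :
    wex (insertPoint i v τ) = wex τ + 1 ∧
      crossings (insertPoint i v τ) = crossings τ + (h - i) := by
  constructor
  · rw [wex_insertPoint, if_pos (by omega), add_comm]
    intro j
    have := hτ j
    simp only [val_succAbove]
    split_ifs <;> omega
  · rw [crossings_insertPoint]
    · have hσ := (avoids_insertPoint_upper hv hi τ).2 hτ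
      have hne : ∀ j, (insertPoint i v τ j : ℕ) = h → j = i := fun j hj => by
        apply (insertPoint i v τ).injective
        rw [insertPoint_self]
        exact Fin.ext (by omega)
      congr 1
      rw [← sum_indicator_Ioc (show h < n + 1 by omega)]
      refine (add_eq_left.2 ?_).trans ?_
      · refine Finset.sum_eq_zero fun j _ => if_neg ?_
        have := hσ j
        unfold ArcCross
        omega
      · refine Finset.sum_congr rfl fun j _ => if_congr ?_ rfl rfl
        have := hσ j
        have := hne j
        rw [Fin.ext_iff] at this
        unfold ArcCross
        omega
    · intro j k
      have := hτ j
      have := hτ k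
      simp only [val_succAbove, ArcCross]
      split_ifs <;> omega

/-- Closing an arc that starts at the first unprocessed position `h` and ends at `v < h`. -/
theorem avoids_insertPoint_lower {n h : ℕ} {i v : Fin (n + 1)} (hi : (i : ℕ) = h)
    (hv : (v : ℕ) < h) (τ : Equiv.Perm (Fin n)) :
    Avoids h h (insertPoint i v τ) ↔ Avoids h (h - 1) τ := by
  rw [avoids_insertPoint_iff, Avoids]
  simp only [val_succAbove]
  constructor
  · rintro ⟨-, H⟩ j hj
    have := H j
    split_ifs at this <;> omega
  · refine fun H => ⟨by omega, fun j hj => ?_⟩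
    have := H j
    split_ifs at hj ⊢ <;> omega

/-- Values in `(v, h-1]` can only be reached from positions beyond `h`, and those arcs are exactly
the ones crossed. -/
theorem weight_insertPoint_lower {n h : ℕ} {i v : Fin (n + 1)} (hi : (i : ℕ) = h)
    (hv : (v : ℕ) < h) {τ : Equiv.Perm (Fin n)} (hτ : Avoids h (h - 1) τ) :
    wex (insertPoint i v τ) = wex τ ∧
      crossings (insertPoint i v τ) = crossings τ + (h - 1 - v) := by
  constructor
  · rw [wex_insertPoint, if_neg (by omega), zero_add]
    intro j
    have := hτ j
    simp only [val_succAbove]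
    split_ifs <;> omega
  · rw [crossings_insertPoint]
    · have hσ := (avoids_insertPoint_lower hi hv τ).2 hτ
      have hne : ∀ j, (insertPoint i v τ j : ℕ) = v → (j : ℕ) = i := fun j hj => by
        congr 1
        apply (insertPoint i v τ).injective
        rw [insertPoint_self]
        exact Fin.ext (by omega)
      have hself : ∀ j : Fin (n + 1), (j : ℕ) = i → (insertPoint i v τ j : ℕ) = v := fun j hj => by
        rw [Fin.ext hj, insertPoint_self]
      congr 1
      rw [← sum_indicator_Ioc (show h - 1 < n + 1 by omega),
        -- The crossing arcs form an interval of values rather than of positions, so they are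
        -- counted through the permutation.
        ← sum_perm_indicator (insertPoint i v τ) (fun j => (v : ℕ) < j ∧ j ≤ h - 1)]
      refine (add_eq_left.2 ?_).trans ?_
      · refine Finset.sum_eq_zero fun j _ => if_neg ?_
        have := hσ j
        unfold ArcCross
        omega
      · refine Finset.sum_congr rfl fun j _ => if_congr ?_ rfl rfl
        have := hσ j
        have := hne j
        have := hself j
        unfold ArcCross
        omega
    · intro j k
      have := hτ j
      have := hτ k
      simp only [val_succAbove, ArcCross]
      split_ifs <;> omega

/-! ### Recurrences for sums over permutations -/

/-- The sum of `(-1) ^ wex σ * q ^ crossings σ` over the permutations of `Fin n` without arcs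
starting below `u` and ending below `l`. -/
noncomputable def signedSum (n u l : ℕ) : ℤ[X] :=
  ∑ σ : Equiv.Perm (Fin n), if Avoids u l σ then
    (-1 : ℤ[X]) ^ wex σ * (Polynomial.X : ℤ[X]) ^ crossings σ else 0

theorem sum_indicator_pow_eq_qInt {n h : ℕ} (hn : h ≤ n) :
    (∑ j : Fin n, if (j : ℕ) < h then (Polynomial.X : ℤ[X]) ^ (h - 1 - j) else 0) = qInt h := by
  rw [Fin.sum_univ_eq_sum_range (fun j => if j < h then (Polynomial.X : ℤ[X]) ^ (h - 1 - j) else 0),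
    ← Finset.sum_filter, qInt, ← Finset.sum_range_reflect]
  congr 1
  ext j
  simp only [Finset.mem_filter, Finset.mem_range]
  omega

/-- The last term collects the permutations whose arc from `h` ends below `h`. For `h = 0` the
truncated `h - 1` is harmless, since `[0] = 0`. -/
theorem signedSum_row {n h : ℕ} (hn : h ≤ n) :
    signedSum (n + 1) h h = signedSum (n + 1) (h + 1) h + qInt h * signedSum n h (h - 1) := by
  set i : Fin (n + 1) := ⟨h, by omega⟩ with hi
  have hi' : (i : ℕ) = h := rfl
  have key : ∀ v τ, (if Avoids h h (insertPoint i v τ) then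
        (-1 : ℤ[X]) ^ wex (insertPoint i v τ) *
          (Polynomial.X : ℤ[X]) ^ crossings (insertPoint i v τ) else 0) =
      (if Avoids (h + 1) h (insertPoint i v τ) then
        (-1 : ℤ[X]) ^ wex (insertPoint i v τ) *
          (Polynomial.X : ℤ[X]) ^ crossings (insertPoint i v τ) else 0) +
      (if (v : ℕ) < h then (Polynomial.X : ℤ[X]) ^ (h - 1 - v) else 0) *
        if Avoids h (h - 1) τ then
          (-1 : ℤ[X]) ^ wex τ * (Polynomial.X : ℤ[X]) ^ crossings τ else 0 := by
    intro v τ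
    by_cases hv : (v : ℕ) < h
    · have hno : ¬ Avoids (h + 1) h (insertPoint i v τ) := fun H => by
        have := H i (by omega)
        rw [insertPoint_self] at this
        omega
      rw [if_neg hno, if_pos hv, zero_add]
      by_cases hτ : Avoids h (h - 1) τ
      · obtain ⟨hw, hc⟩ := weight_insertPoint_lower hi' hv hτ
        rw [if_pos ((avoids_insertPoint_lower hi' hv τ).2 hτ), if_pos hτ, hw, hc, pow_add]
        ring
      · rw [if_neg (mt (avoids_insertPoint_lower hi' hv τ).1 hτ), if_neg hτ, mul_zero]
    · rw [if_neg hv, zero_mul, add_zero]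
      refine if_congr ⟨fun H j hj => ?_, fun H j hj => H j (by omega)⟩ rfl rfl
      by_cases hji : j = i
      · rw [hji, insertPoint_self]
        omega
      · exact H j (by rw [Fin.ext_iff] at hji; omega)
  simp only [signedSum, sum_perm_insert_value i, key, Finset.sum_add_distrib,
    ← Finset.mul_sum, ← Finset.sum_mul]
  rw [sum_indicator_pow_eq_qInt (by omega)]

/-- The arc into `h` either starts beyond `h` or is a weak exceedance, whence the minus sign. -/
theorem signedSum_column {n h : ℕ} (hn : h ≤ n) :
    signedSum (n + 1) (h + 1) h =
      signedSum (n + 1) (h + 1) (h + 1) - qInt (h + 1) * signedSum n h h := by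
  set v : Fin (n + 1) := ⟨h, by omega⟩ with hv
  have hv' : (v : ℕ) = h := rfl
  have key : ∀ i τ, (if Avoids (h + 1) h (insertPoint i v τ) then
        (-1 : ℤ[X]) ^ wex (insertPoint i v τ) *
          (Polynomial.X : ℤ[X]) ^ crossings (insertPoint i v τ) else 0) =
      (if Avoids (h + 1) (h + 1) (insertPoint i v τ) then
        (-1 : ℤ[X]) ^ wex (insertPoint i v τ) *
          (Polynomial.X : ℤ[X]) ^ crossings (insertPoint i v τ) else 0) -
      (if (i : ℕ) < h + 1 then (Polynomial.X : ℤ[X]) ^ (h + 1 - 1 - i) else 0) *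
        if Avoids h h τ then
          (-1 : ℤ[X]) ^ wex τ * (Polynomial.X : ℤ[X]) ^ crossings τ else 0 := by
    intro i τ
    by_cases hi : (i : ℕ) < h + 1
    · have hi' : (i : ℕ) ≤ h := by omega
      have hno : ¬ Avoids (h + 1) (h + 1) (insertPoint i v τ) := fun H => by
        have := H i hi
        rw [insertPoint_self] at this
        omega
      rw [if_neg hno, if_pos hi, zero_sub]
      by_cases hτ : Avoids h h τ
      · obtain ⟨hw, hc⟩ := weight_insertPoint_upper hv' hi' hτ
        rw [if_pos ((avoids_insertPoint_upper hv' hi' τ).2 hτ), if_pos hτ, hw, hc,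
          Nat.add_sub_cancel]
        ring
      · rw [if_neg (mt (avoids_insertPoint_upper hv' hi' τ).1 hτ), if_neg hτ, mul_zero, neg_zero]
    · rw [if_neg hi, zero_mul, sub_zero]
      refine if_congr ⟨fun H j hj => ?_, fun H j hj => (Nat.le_succ h).trans (H j hj)⟩ rfl rfl
      refine lt_of_le_of_ne (H j hj) fun hj' => hi ?_
      have : j = i := by
        apply (insertPoint i v τ).injective
        rw [insertPoint_self]
        exact Fin.ext hj'.symm
      rwa [← this]
  simp only [signedSum, sum_perm_insert_position v, key, Finset.sum_sub_distrib,
    ← Finset.mul_sum, ← Finset.sum_mul]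
  rw [sum_indicator_pow_eq_qInt (by omega)]

/-! ### Three-term recurrence in the corner size -/

theorem qInt_succ (n : ℕ) : qInt (n + 1) = qInt n + Polynomial.X ^ n :=
  Finset.sum_range_succ _ n

theorem qInt_zero : qInt 0 = 0 := Finset.sum_range_zero _

theorem qInt_one : qInt 1 = 1 := by simp [qInt]

theorem signedSum_self (h : ℕ) : signedSum h h h = if h = 0 then 1 else 0 := by
  rcases h with - | h
  · simp [signedSum, Avoids, wex, crossings]
  · rw [if_neg h.succ_ne_zero]
    refine Finset.sum_eq_zero fun σ _ => if_neg fun H => ?_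
    have := H 0 (by simp)
    have := (σ 0).isLt
    omega

theorem signedSum_zero_step (m : ℕ) :
    signedSum (m + 1) 0 0 = signedSum (m + 1) 1 1 - signedSum m 0 0 := by
  rw [signedSum_row m.zero_le, signedSum_column m.zero_le, qInt_zero, zero_add, qInt_one]
  ring

theorem signedSum_succ_step (m h : ℕ) :
    signedSum (h + 1 + m + 1) (h + 1) (h + 1) =
      signedSum (h + 1 + m + 1) (h + 2) (h + 2) -
        Polynomial.X ^ (h + 1) * signedSum (h + 1 + m) (h + 1) (h + 1) -
        qInt (h + 1) ^ 2 * signedSum (h + m) h h := by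
  rw [signedSum_row (by omega), signedSum_column (by omega), Nat.add_sub_cancel,
    qInt_succ (h + 1), show h + 1 + m = h + m + 1 by ring, signedSum_column (by omega)]
  ring

/-! ### The continued fraction -/

theorem X_pow_dvd_contFrac_sub {R : Type*} [CommRing R] (c : ℕ → R) (N : ℕ) :
    (PowerSeries.X : R⟦X⟧) ^ (N + 1) ∣ contFrac c - cfConvergent N c := by
  rw [PowerSeries.X_pow_dvd_iff]
  intro m hm
  rw [map_sub, coeff_cfConvergent c (by omega : m ≤ N), sub_self]

theorem contFrac_eq {R : Type*} [CommRing R] (c : ℕ → R) :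
    contFrac c = 1 + PowerSeries.C (c 0) * PowerSeries.X * contFrac c *
      contFrac fun k => c (k + 1) := by
  rw [← sub_eq_zero]
  ext m
  rw [map_zero]
  refine PowerSeries.X_pow_dvd_iff.mp ?_ m m.lt_add_one
  obtain ⟨d, hd⟩ := X_pow_dvd_contFrac_sub c (m + 1)
  obtain ⟨e, he⟩ := X_pow_dvd_contFrac_sub (fun k => c (k + 1)) m
  have h := cfConvergent_mul m c
  -- The witness is the error made when both fractions in the exact identity `cfConvergent_mul` are
  -- replaced by their limits.
  refine ⟨PowerSeries.X * d * (1 - PowerSeries.C (c 0) * PowerSeries.X *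
      contFrac fun k => c (k + 1)) -
    PowerSeries.C (c 0) * PowerSeries.X * cfConvergent (m + 1) c * e, ?_⟩
  linear_combination h + (1 - PowerSeries.C (c 0) * PowerSeries.X *
      contFrac fun k => c (k + 1)) * hd -
    PowerSeries.C (c 0) * PowerSeries.X * cfConvergent (m + 1) c * he

/-! ### Closed form of the generating functions -/

/-- The tail `1 / (1 + [k+1][k+2] x² / (1 + [k+2][k+3] x² / ⋯))` of the continued fraction of the
`q`-tangent numbers at `-x²`. -/
noncomputable def tangentTail (k : ℕ) : ℤ[X]⟦X⟧ :=
  PowerSeries.expand 2 two_ne_zero (PowerSeries.rescale (-1)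
    (contFrac fun j => qInt (j + k + 1) * qInt (j + k + 2)))

theorem tangentTail_eq (k : ℕ) :
    tangentTail k = 1 - PowerSeries.C (qInt (k + 1)) * PowerSeries.C (qInt (k + 2)) *
      PowerSeries.X ^ 2 * tangentTail k * tangentTail (k + 1) := by
  have h := congrArg (fun f => PowerSeries.expand 2 two_ne_zero (PowerSeries.rescale (-1) f))
    (contFrac_eq fun j => qInt (j + k + 1) * qInt (j + k + 2))
  have hC : ∀ a : ℤ[X], PowerSeries.rescale (-1) (PowerSeries.C a) = PowerSeries.C a := by
    intro a
    ext n
    rcases n with - | n <;> simp [PowerSeries.coeff_rescale, PowerSeries.coeff_C]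
  have hs : (fun j => qInt (j + (k + 1) + 1) * qInt (j + (k + 1) + 2)) =
      fun j => qInt (j + 1 + k + 1) * qInt (j + 1 + k + 2) := by
    funext j
    congr 2 <;> ring
  simp only [map_add, map_mul, map_one, hC, PowerSeries.rescale_X, PowerSeries.expand_C,
    PowerSeries.expand_X, map_neg] at h
  rw [tangentTail, tangentTail, hs]
  simp only [zero_add] at h
  linear_combination h

theorem coeff_tangentTail_zero (n : ℕ) :
    PowerSeries.coeff n (tangentTail 0) =
      if 2 ∣ n then (-1) ^ (n / 2) * qTangent (n / 2) else 0 := by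
  simp only [tangentTail, PowerSeries.coeff_expand, PowerSeries.coeff_rescale, qTangent, add_zero]

/-- The product of the factors `-[k]² x / (1 + [k][k+1] x² / ⋯)` for `1 ≤ k ≤ h`. -/
noncomputable def tailProd : ℕ → ℤ[X]⟦X⟧
  | 0 => 1
  | h + 1 => -(PowerSeries.C (qInt (h + 1)) ^ 2 * PowerSeries.X * tangentTail h * tailProd h)

/-- The generating function of `signedSum (h + m) h h`, in closed form. -/
noncomputable def signedSeries (h : ℕ) : ℤ[X]⟦X⟧ :=
  (1 - PowerSeries.C (qInt (h + 1)) * PowerSeries.X * tangentTail h) * tailProd h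

theorem signedSeries_zero_step :
    signedSeries 0 = 1 + PowerSeries.X * (signedSeries 1 - signedSeries 0) := by
  have h := tangentTail_eq 0
  simp only [signedSeries, tailProd, zero_add, qInt_one, map_one] at h ⊢
  linear_combination -PowerSeries.X * h

/-- The tail equation at `h + 1` eliminates `T_(h+2)`; what remains is a multiple of the one at `h`.
-/
theorem signedSeries_succ_step (h : ℕ) :
    signedSeries (h + 1) = PowerSeries.X * (signedSeries (h + 2) -
      PowerSeries.C (Polynomial.X ^ (h + 1)) * signedSeries (h + 1) -
        PowerSeries.C (qInt (h + 1) ^ 2) * signedSeries h) := by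
  have h0 := tangentTail_eq h
  have h1 := tangentTail_eq (h + 1)
  have hq : (PowerSeries.C (Polynomial.X ^ (h + 1)) : ℤ[X]⟦X⟧) =
      PowerSeries.C (qInt (h + 2)) - PowerSeries.C (qInt (h + 1)) := by
    rw [← map_sub, qInt_succ (h + 1)]
    congr 1
    ring
  simp only [signedSeries, tailProd, hq, map_pow]
  linear_combination
    PowerSeries.C (qInt (h + 1)) ^ 2 * PowerSeries.X * tailProd h *
      (PowerSeries.C (qInt (h + 2)) * PowerSeries.X * tangentTail h * h1 - h0)

/-- The induction on `m` treats all `h` at once, because each step uses neighbouring corner sizes.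
-/
theorem coeff_signedSeries (m : ℕ) :
    ∀ h : ℕ, PowerSeries.coeff m (signedSeries h) = signedSum (h + m) h h := by
  induction m with
  | zero =>
    rintro (- | h)
    · simp [signedSum_self, signedSeries, tailProd]
    · simp [signedSum_self, signedSeries, tailProd]
  | succ m ih =>
    rintro (- | h)
    · rw [signedSeries_zero_step, map_add, PowerSeries.coeff_succ_X_mul, map_sub, ih, ih,
        PowerSeries.coeff_one, if_neg m.succ_ne_zero, zero_add, zero_add, zero_add,
        signedSum_zero_step, add_comm 1 m]
    · rw [signedSeries_succ_step, PowerSeries.coeff_succ_X_mul, map_sub, map_sub,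
        PowerSeries.coeff_C_mul, PowerSeries.coeff_C_mul, ih, ih, ih, ← add_assoc,
        signedSum_succ_step]
      congr 3
      ring

theorem sum_perm_eq_coeff (n : ℕ) :
    ∑ σ : Equiv.Perm (Fin n), (-1 : ℤ[X]) ^ wex σ * (Polynomial.X : ℤ[X]) ^ crossings σ =
      PowerSeries.coeff n (1 - PowerSeries.X * tangentTail 0) := by
  have h := coeff_signedSeries n 0
  simp only [signedSeries, tailProd, zero_add, qInt_one, map_one, one_mul, mul_one] at h
  rw [h, signedSum]
  exact Finset.sum_congr rfl fun σ _ => (if_pos fun i hi => absurd hi (Nat.not_lt_zero _)).symm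

theorem theorem1 (n : ℕ) (hn : 1 ≤ n) :
    (Even n →
      ∑ σ : Equiv.Perm (Fin n),
        (-1 : ℤ[X]) ^ wex σ * (Polynomial.X : ℤ[X]) ^ crossings σ = 0) ∧
    (∀ m : ℕ, n = 2 * m + 1 →
      ∑ σ : Equiv.Perm (Fin n),
        (-1 : ℤ[X]) ^ wex σ * (Polynomial.X : ℤ[X]) ^ crossings σ =
          (-1 : ℤ[X]) ^ ((n + 1) / 2) * qTangent m) := by
  obtain ⟨n, rfl⟩ : ∃ k, n = k + 1 := ⟨n - 1, by omega⟩
  rw [sum_perm_eq_coeff, map_sub, PowerSeries.coeff_one, if_neg n.succ_ne_zero, zero_sub,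
    PowerSeries.coeff_succ_X_mul, coeff_tangentTail_zero]
  constructor
  · rintro ⟨k, hk⟩
    rw [if_neg (by omega), neg_zero]
  · intro m hm
    obtain rfl : n = 2 * m := by omega
    rw [if_pos (Dvd.intro _ rfl), Nat.mul_div_cancel_left _ two_pos,
      show (2 * m + 1 + 1) / 2 = m + 1 by omega]
    ring
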